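/- For a prime $p \equiv 1 \pmod 4$ let $h$ be the class number of the real quadratic field $\mathbb{Q}(\sqrt p)$, let $\varepsilon > 1$ be its fundamental unit (the unit of the ring of integers with $\varepsilon>1$ such that every unit is $\pm\varepsilon^n$ for some $n \in \mathbb{Z}$), and put $$\beta = \beta(p) = \frac{\log p + 2h\log\varepsilon}{(p-1)\log 2}.$$ Let $\mathcal{P}_{2,1}$ be the set of primes $p \equiv 1 \pmod 4$ for which $2$ has multiplicative order exactly $(p-1)/2$ modulo $p$. Then only finitely many $p \in \mathcal{P}_{2,1}$ satisfy $\beta(p) > 1/2$; in fact, $p = 17$ is the only such prime: $\{p \in \mathcal{P}_{2,1} : \beta(p) > 1/2\} = \{17\}$. -/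

import Mathlib

open scoped NumberField IntermediateField

namespace ThueMorse

/-- The quadratic field `ℚ(√d)`, as a subfield of `ℝ`. -/
noncomputable abbrev QSqrt (d : ℕ) : IntermediateField ℚ ℝ := ℚ⟮√(d : ℝ)⟯

theorem isIntegral_sqrt (d : ℕ) : IsIntegral ℚ √(d : ℝ) := by
  refine IsIntegral.of_pow (n := 2) two_pos ?_
  rw [Real.sq_sqrt d.cast_nonneg]
  simpa using (isIntegral_algebraMap (R := ℚ) (A := ℝ) (x := (d : ℚ)))

noncomputable instance (d : ℕ) : NumberField (QSqrt d) where
  to_charZero := inferInstance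
  to_finiteDimensional := IntermediateField.adjoin.finiteDimensional (isIntegral_sqrt d)

/-- The real number underlying a unit of the ring of integers of `ℚ(√d) ⊆ ℝ`. -/
noncomputable def unitVal (d : ℕ) (u : (𝓞 (QSqrt d))ˣ) : ℝ :=
  (((u : 𝓞 (QSqrt d)) : QSqrt d) : ℝ)

/-- `u` is the fundamental unit `> 1` of `ℚ(√d)`: every unit of the ring of integers is, up to
sign, an integral power of `u`. -/
def IsFundamentalUnit (d : ℕ) (u : (𝓞 (QSqrt d))ˣ) : Prop :=
  1 < unitVal d u ∧ ∀ v : (𝓞 (QSqrt d))ˣ, ∃ n : ℤ, v = u ^ n ∨ v = -u ^ n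

/-- The real number `ε > 1` given by the fundamental unit of `ℚ(√d)`. It is well defined for `d`
prime by `exists_isFundamentalUnit` and `IsFundamentalUnit.unique` below. -/
noncomputable def fundamentalUnit (d : ℕ) : ℝ :=
  unitVal d (Classical.epsilon (IsFundamentalUnit d))

theorem finrank_QSqrt {p : ℕ} (hp : p.Prime) : Module.finrank ℚ (QSqrt p) = 2 := by
  rw [IntermediateField.adjoin.finrank (isIntegral_sqrt p)]
  apply le_antisymm
  · have hm : (Polynomial.X ^ 2 - Polynomial.C (p : ℚ)).Monic :=
      Polynomial.monic_X_pow_sub_C _ two_ne_zero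
    have := minpoly.min ℚ √(p : ℝ) hm (by simp)
    rw [Polynomial.degree_X_pow_sub_C two_pos] at this
    exact Polynomial.natDegree_le_of_degree_le this
  · rw [minpoly.two_le_natDegree_iff (isIntegral_sqrt p)]
    rintro ⟨q, hq⟩
    exact hp.irrational_sqrt ⟨q, by simpa using hq⟩

theorem rank_QSqrt {p : ℕ} (hp : p.Prime) : NumberField.Units.rank (QSqrt p) = 1 := by
  classical
  have h := NumberField.InfinitePlace.card_add_two_mul_card_eq_rank (QSqrt p)
  rw [finrank_QSqrt hp] at h
  have h2 := NumberField.InfinitePlace.card_eq_nrRealPlaces_add_nrComplexPlaces (QSqrt p)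
  let φ : QSqrt p →+* ℂ := Complex.ofRealHom.comp (algebraMap (QSqrt p) ℝ)
  have hφ : NumberField.ComplexEmbedding.IsReal φ := by
    ext x
    simp [φ]
  have hpos : 0 < NumberField.InfinitePlace.nrRealPlaces (QSqrt p) :=
    Fintype.card_pos_iff.2 ⟨⟨NumberField.InfinitePlace.mk φ, ⟨φ, hφ, rfl⟩⟩⟩
  unfold NumberField.Units.rank
  omega

/-- `unitVal` as a monoid homomorphism. -/
noncomputable def unitValHom (d : ℕ) : (𝓞 (QSqrt d))ˣ →* ℝˣ :=
  Units.map ((algebraMap (QSqrt d) ℝ).comp (algebraMap (𝓞 (QSqrt d)) (QSqrt d)) : _ →* ℝ)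

theorem unitValHom_val (d : ℕ) (u : (𝓞 (QSqrt d))ˣ) :
    ((unitValHom d u : ℝˣ) : ℝ) = unitVal d u := rfl

theorem unitVal_injective (d : ℕ) : Function.Injective (unitVal d) := by
  intro u v h
  exact Units.ext (NumberField.RingOfIntegers.coe_injective (Subtype.ext h))

theorem unitVal_zpow (d : ℕ) (u : (𝓞 (QSqrt d))ˣ) (n : ℤ) :
    unitVal d (u ^ n) = unitVal d u ^ n := by
  rw [← unitValHom_val, map_zpow, Units.val_zpow_eq_zpow_val, unitValHom_val]

theorem unitVal_neg (d : ℕ) (u : (𝓞 (QSqrt d))ˣ) : unitVal d (-u) = -unitVal d u := by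
  simp [unitVal]

theorem unitVal_ne_zero (d : ℕ) (u : (𝓞 (QSqrt d))ˣ) : unitVal d u ≠ 0 :=
  (unitValHom d u).ne_zero

theorem torsion_eq {d : ℕ} {u : (𝓞 (QSqrt d))ˣ}
    (h : u ∈ NumberField.Units.torsion (QSqrt d)) : u = 1 ∨ u = -1 := by
  obtain ⟨n, hn, h1⟩ := isOfFinOrder_iff_pow_eq_one.1 h
  have h2 : unitVal d u ^ n = 1 := by
    have := unitVal_zpow d u n
    rw [zpow_natCast, zpow_natCast, h1] at this
    simpa [unitVal] using this.symm
  have h3 : |unitVal d u| = 1 := by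
    have : |unitVal d u| ^ n = 1 := by rw [← abs_pow, h2, abs_one]
    exact (pow_eq_one_iff_of_nonneg (abs_nonneg _) hn.ne').1 this
  rcases abs_eq zero_le_one |>.1 h3 with h | h
  · exact Or.inl (unitVal_injective d (by rw [h]; simp [unitVal]))
  · exact Or.inr (unitVal_injective d (by rw [h]; simp [unitVal]))

theorem fundSystem_notMem_torsion (K : Type*) [Field K] [NumberField K]
    (i : Fin (NumberField.Units.rank K)) :
    NumberField.Units.fundSystem K i ∉ NumberField.Units.torsion K := by
  intro hs
  have h := (NumberField.Units.exist_unique_eq_mul_prod K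
    (NumberField.Units.fundSystem K i)).unique
    (y₁ := (⟨_, hs⟩, 0)) (y₂ := (1, Pi.single i 1)) (by simp) (by
      rw [Fintype.prod_eq_single i (fun j hj => by simp [Pi.single_eq_of_ne hj])]
      simp)
  simpa using congrFun (congrArg Prod.snd h) i

theorem exists_isFundamentalUnit {p : ℕ} (hp : p.Prime) : ∃ u, IsFundamentalUnit p u := by
  have hr := rank_QSqrt hp
  let i0 : Fin (NumberField.Units.rank (QSqrt p)) := ⟨0, by omega⟩
  have hsub : ∀ i, i = i0 := fun i => Fin.ext (by have := i.2; simp only [i0]; omega)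
  -- a unit generating the units up to sign
  set e := NumberField.Units.fundSystem (QSqrt p) i0 with he
  have hgen : ∀ v : (𝓞 (QSqrt p))ˣ, ∃ n : ℤ, v = e ^ n ∨ v = -e ^ n := by
    intro v
    obtain ⟨⟨ζ, f⟩, hv, -⟩ := NumberField.Units.exist_unique_eq_mul_prod (QSqrt p) v
    refine ⟨f i0, ?_⟩
    rw [Fintype.prod_eq_single i0 (fun i hi => absurd (hsub i) hi)] at hv
    rcases torsion_eq ζ.2 with h | h
    · left; simpa [h] using hv
    · right; simpa [h] using hv
  have hne : unitVal p e ≠ 0 := unitVal_ne_zero p e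
  have habs : |unitVal p e| ≠ 1 := by
    intro h
    have hs : e ∈ NumberField.Units.torsion (QSqrt p) := by
      refine isOfFinOrder_iff_pow_eq_one.2 ⟨2, two_pos, unitVal_injective p ?_⟩
      have := unitVal_zpow p e (2 : ℕ)
      rw [zpow_natCast, zpow_natCast] at this
      rw [this, ← sq_abs, h]
      simp [unitVal]
    exact fundSystem_notMem_torsion (QSqrt p) i0 hs
  -- replace the generator by whichever of `±e`, `±e⁻¹` exceeds `1`
  have key : ∃ w : (𝓞 (QSqrt p))ˣ, 1 < |unitVal p w| ∧
      ∀ v : (𝓞 (QSqrt p))ˣ, ∃ n : ℤ, v = w ^ n ∨ v = -w ^ n := by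
    rcases lt_or_gt_of_ne habs with h | h
    · refine ⟨e⁻¹, ?_, fun v => ?_⟩
      · have := unitVal_zpow p e (-1)
        rw [zpow_neg_one, zpow_neg_one] at this
        rw [this, abs_inv]
        exact (one_lt_inv₀ (abs_pos.2 hne)).2 h
      · obtain ⟨n, hn⟩ := hgen v
        exact ⟨-n, by simpa using hn⟩
    · exact ⟨e, h, hgen⟩
  obtain ⟨w, hw, hg⟩ := key
  rcases lt_or_ge 0 (unitVal p w) with h | h
  · exact ⟨w, by rwa [abs_of_pos h] at hw, hg⟩
  · refine ⟨-w, by rwa [abs_of_nonpos h, ← unitVal_neg] at hw, fun v => ?_⟩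
    obtain ⟨n, hn⟩ := hg v
    refine ⟨n, ?_⟩
    rcases Int.even_or_odd n with he | ho
    · rwa [he.neg_zpow]
    · rw [ho.neg_zpow, neg_neg]
      exact hn.symm

theorem IsFundamentalUnit.le {d : ℕ} {u v : (𝓞 (QSqrt d))ˣ} (hu : IsFundamentalUnit d u)
    (hv : 1 < unitVal d v) : unitVal d u ≤ unitVal d v := by
  obtain ⟨n, hn⟩ := hu.2 v
  have hpos : 0 < unitVal d u ^ n := zpow_pos (by linarith [hu.1]) n
  rcases hn with hn | hn
  · rw [hn, unitVal_zpow] at hv ⊢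
    have : 0 < n := (one_lt_zpow_iff_right₀ hu.1).1 hv
    simpa using zpow_le_zpow_right₀ hu.1.le (show (1 : ℤ) ≤ n by omega)
  · rw [hn, unitVal_neg, unitVal_zpow] at hv
    linarith

theorem IsFundamentalUnit.unique {d : ℕ} {u v : (𝓞 (QSqrt d))ˣ} (hu : IsFundamentalUnit d u)
    (hv : IsFundamentalUnit d v) : u = v :=
  unitVal_injective d (le_antisymm (hu.le hv.1) (hv.le hu.1))

theorem fundamentalUnit_eq {d : ℕ} {u : (𝓞 (QSqrt d))ˣ} (hu : IsFundamentalUnit d u) :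
    fundamentalUnit d = unitVal d u := by
  rw [fundamentalUnit, (Classical.epsilon_spec ⟨u, hu⟩ : IsFundamentalUnit d _).unique hu]

/-- The primes `p ≡ 1 (mod 4)` for which `2` has multiplicative order `(p - 1) / 2` modulo `p`. -/
def P21 : Set ℕ :=
  {p | p.Prime ∧ p % 4 = 1 ∧ orderOf (2 : ZMod p) = (p - 1) / 2}

/-- `β = (log p + 2 h log ε) / ((p - 1) log 2)`, with `h` the class number and `ε > 1` the
fundamental unit of `ℚ(√p)`. -/
noncomputable def beta (p : ℕ) : ℝ :=
  (Real.log p + 2 * (NumberField.classNumber (QSqrt p) : ℝ) * Real.log (fundamentalUnit p)) /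
    (((p : ℝ) - 1) * Real.log 2)

end ThueMorse

namespace ThueMorse

/-- The element `√d` of `ℚ(√d)`. -/
noncomputable def sqrtElt (d : ℕ) : QSqrt d := IntermediateField.AdjoinSimple.gen ℚ √(d : ℝ)

theorem coe_sqrtElt (d : ℕ) : ((sqrtElt d : QSqrt d) : ℝ) = √(d : ℝ) := rfl

theorem sqrtElt_sq (d : ℕ) : sqrtElt d ^ 2 = d := by
  apply Subtype.ext
  simp [coe_sqrtElt]

theorem minpoly_sqrt {p : ℕ} (hp : p.Prime) :
    minpoly ℚ √(p : ℝ) = Polynomial.X ^ 2 - Polynomial.C (p : ℚ) := by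
  have hm : (Polynomial.X ^ 2 - Polynomial.C (p : ℚ)).Monic :=
    Polynomial.monic_X_pow_sub_C _ two_ne_zero
  refine (Polynomial.eq_of_monic_of_dvd_of_natDegree_le (minpoly.monic (isIntegral_sqrt p)) hm
    (minpoly.dvd _ _ (by simp)) ?_).symm
  rw [← IntermediateField.adjoin.finrank (isIntegral_sqrt p), finrank_QSqrt hp,
    Polynomial.natDegree_X_pow_sub_C]

theorem trace_sqrtElt {p : ℕ} (hp : p.Prime) : Algebra.trace ℚ (QSqrt p) (sqrtElt p) = 0 := by
  have h := (IntermediateField.adjoin.powerBasis (isIntegral_sqrt p)).trace_gen_eq_nextCoeff_minpoly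
  rw [IntermediateField.adjoin.powerBasis_gen, IntermediateField.minpoly_gen, minpoly_sqrt hp] at h
  refine h.trans ?_
  have hd : (Polynomial.X ^ 2 - Polynomial.C (p : ℚ)).natDegree = 2 :=
    Polynomial.natDegree_X_pow_sub_C
  rw [Polynomial.nextCoeff_of_natDegree_pos (by omega), hd, Polynomial.coeff_sub,
    Polynomial.coeff_X_pow, Polynomial.coeff_C]
  simp

/-- The element `(1 + √p) / 2` of `ℚ(√p)` is integral for `p ≡ 1 (mod 4)`. -/
theorem isIntegral_half_one_add_sqrtElt {p : ℕ} (h4 : p % 4 = 1) :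
    IsIntegral ℤ ((1 + sqrtElt p) / 2) := by
  refine ⟨Polynomial.X ^ 2 - Polynomial.X - Polynomial.C ((p / 4 : ℕ) : ℤ), by monicity!, ?_⟩
  have h : (p : QSqrt p) = 4 * ((p / 4 : ℕ) : QSqrt p) + 1 := by
    exact_mod_cast congrArg (Nat.cast : ℕ → QSqrt p) (show p = 4 * (p / 4) + 1 by omega)
  have h2 := sqrtElt_sq p
  rw [Polynomial.eval₂_sub, Polynomial.eval₂_sub, Polynomial.eval₂_X_pow, Polynomial.eval₂_X,
    Polynomial.eval₂_C, eq_intCast, Int.cast_natCast]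
  rw [h] at h2
  linear_combination h2 / 4

theorem abs_discr_le {p : ℕ} (hp : p.Prime) (h4 : p % 4 = 1) :
    |NumberField.discr (QSqrt p)| ≤ p := by
  classical
  let θ : 𝓞 (QSqrt p) := ⟨(1 + sqrtElt p) / 2, isIntegral_half_one_add_sqrtElt h4⟩
  have hcard : Fintype.card (Module.Free.ChooseBasisIndex ℤ (𝓞 (QSqrt p))) = 2 := by
    rw [← Module.finrank_eq_card_chooseBasisIndex, NumberField.RingOfIntegers.rank,
      finrank_QSqrt hp]
  let e := Fintype.equivFinOfCardEq hcard
  let b : Module.Basis (Fin 2) ℤ (𝓞 (QSqrt p)) :=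
    (NumberField.RingOfIntegers.basis (QSqrt p)).reindex e
  have hb := NumberField.discr_eq_discr (QSqrt p) b
  let v : Fin 2 → 𝓞 (QSqrt p) := ![1, θ]
  have h1 : Algebra.discr ℤ v = (b.toMatrix v).det ^ 2 * NumberField.discr (QSqrt p) := by
    rw [← hb, ← Algebra.discr_of_matrix_vecMul, b.toMatrix_map_vecMul]
  have htr1 : Algebra.trace ℚ (QSqrt p) 1 = 2 := by
    rw [← map_one (algebraMap ℚ (QSqrt p)), Algebra.trace_algebraMap, finrank_QSqrt hp]; simp
  have htr (x : 𝓞 (QSqrt p)) : ((Algebra.trace ℤ (𝓞 (QSqrt p)) x : ℤ) : ℚ) =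
      Algebra.trace ℚ (QSqrt p) x := by
    simpa using (Algebra.trace_localization ℤ (nonZeroDivisors ℤ) (Rₘ := ℚ) (Sₘ := QSqrt p) x).symm
  have hθ : (θ : QSqrt p) = (1/2 : ℚ) • (1 + sqrtElt p) := by
    have : (θ : QSqrt p) = (1 + sqrtElt p) / 2 := rfl
    rw [Algebra.smul_def, this, map_div₀, map_one, map_ofNat]; ring
  have hθ2 : ((θ * θ : 𝓞 (QSqrt p)) : QSqrt p) =
      (((p + 1) / 4 : ℚ)) • (1 : QSqrt p) + (1/2 : ℚ) • sqrtElt p := by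
    have := sqrtElt_sq p
    rw [show ((θ * θ : 𝓞 (QSqrt p)) : QSqrt p) = (θ : QSqrt p) * θ from rfl, hθ]
    simp only [Algebra.smul_def, map_div₀, map_add, map_one, map_ofNat, map_natCast]
    linear_combination this / 4
  have h2 : ((Algebra.discr ℤ v : ℤ) : ℚ) = p := by
    rw [Algebra.discr_def, Matrix.det_fin_two]
    simp only [Algebra.traceMatrix_apply, Algebra.traceForm_apply, v, Matrix.cons_val_zero,
      Matrix.cons_val_one, mul_one, one_mul]
    push_cast
    rw [htr, htr, htr, hθ2, hθ]
    simp only [map_add, map_smul, htr1, trace_sqrtElt hp, map_one, smul_eq_mul]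
    ring
  have h3 : Algebra.discr ℤ v = p := by exact_mod_cast h2
  rw [h3] at h1
  have hdet : (b.toMatrix v).det ≠ 0 := by
    intro h; rw [h] at h1; simp at h1; exact hp.ne_zero h1
  have h4 : (1 : ℤ) ≤ (b.toMatrix v).det ^ 2 := by
    have := sq_pos_of_ne_zero hdet; omega
  have : |(p : ℤ)| = (b.toMatrix v).det ^ 2 * |NumberField.discr (QSqrt p)| := by
    rw [h1, abs_mul, abs_of_nonneg (sq_nonneg _)]
  rw [Nat.abs_cast] at this
  rw [this]
  exact le_mul_of_one_le_left (abs_nonneg _) h4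

theorem nrRealPlaces_nrComplexPlaces {p : ℕ} (hp : p.Prime) :
    NumberField.InfinitePlace.nrRealPlaces (QSqrt p) = 2 ∧
      NumberField.InfinitePlace.nrComplexPlaces (QSqrt p) = 0 := by
  classical
  have h := NumberField.InfinitePlace.card_add_two_mul_card_eq_rank (QSqrt p)
  rw [finrank_QSqrt hp] at h
  have h2 := NumberField.InfinitePlace.card_eq_nrRealPlaces_add_nrComplexPlaces (QSqrt p)
  have h3 := rank_QSqrt hp
  unfold NumberField.Units.rank at h3
  omega

theorem torsionOrder_le_two (d : ℕ) : NumberField.Units.torsionOrder (QSqrt d) ≤ 2 := by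
  classical
  rw [NumberField.Units.torsionOrder]
  have : (NumberField.Units.torsion (QSqrt d) : Set (𝓞 (QSqrt d))ˣ) ⊆ {1, -1} :=
    fun u hu => by simpa using torsion_eq hu
  calc _ = (NumberField.Units.torsion (QSqrt d) : Set (𝓞 (QSqrt d))ˣ).ncard := rfl
    _ ≤ ({1, -1} : Set (𝓞 (QSqrt d))ˣ).ncard := Set.ncard_le_ncard this (by simp)
    _ ≤ 2 := (Set.ncard_insert_le _ _).trans (by simp)

theorem fundamentalUnit_spec {p : ℕ} (hp : p.Prime) :
    ∃ u, IsFundamentalUnit p u ∧ fundamentalUnit p = unitVal p u := by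
  obtain ⟨u, hu⟩ := exists_isFundamentalUnit hp
  exact ⟨u, hu, fundamentalUnit_eq hu⟩

theorem log_fundamentalUnit_le {p : ℕ} (hp : p.Prime) {v : (𝓞 (QSqrt p))ˣ}
    (hv : v ∉ NumberField.Units.torsion (QSqrt p)) :
    Real.log (fundamentalUnit p) ≤ |Real.log (|unitVal p v|)| := by
  obtain ⟨u, hu, hε⟩ := fundamentalUnit_spec hp
  rw [hε]
  obtain ⟨n, hn⟩ := hu.2 v
  have hn0 : n ≠ 0 := by
    rintro rfl
    apply hv
    refine isOfFinOrder_iff_pow_eq_one.2 ⟨2, two_pos, ?_⟩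
    rcases hn with hn | hn <;> simp [hn]
  have h0 : 0 < Real.log (unitVal p u) := Real.log_pos hu.1
  have h1 : Real.log (|unitVal p v|) = n * Real.log (unitVal p u) := by
    rw [Real.log_abs]
    rcases hn with hn | hn
    · rw [hn, unitVal_zpow, Real.log_zpow]
    · rw [hn, unitVal_neg, unitVal_zpow, Real.log_neg_eq_log, Real.log_zpow]
  rw [h1, abs_mul, abs_of_pos h0]
  refine le_mul_of_one_le_left h0.le ?_
  exact_mod_cast Int.one_le_abs hn0

theorem log_fundamentalUnit_le_regulator {p : ℕ} (hp : p.Prime) :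
    Real.log (fundamentalUnit p) ≤ NumberField.Units.regulator (QSqrt p) := by
  classical
  let φ : QSqrt p →+* ℂ := Complex.ofRealHom.comp (algebraMap (QSqrt p) ℝ)
  have hφ : NumberField.ComplexEmbedding.IsReal φ := by
    ext x
    simp [φ]
  let w₀ := NumberField.InfinitePlace.mk φ
  have hcard : Fintype.card (NumberField.InfinitePlace (QSqrt p)) = 2 := by
    rw [NumberField.InfinitePlace.card_eq_nrRealPlaces_add_nrComplexPlaces,
      (nrRealPlaces_nrComplexPlaces hp).1, (nrRealPlaces_nrComplexPlaces hp).2]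
  obtain ⟨w', hw'⟩ := Fintype.exists_ne_of_one_lt_card (by omega) w₀
  have hc : Fintype.card {w : NumberField.InfinitePlace (QSqrt p) // w ≠ w'} =
      Fintype.card (Fin (NumberField.Units.rank (QSqrt p))) := by
    rw [Fintype.card_subtype_compl, Fintype.card_subtype_eq, hcard, Fintype.card_fin, rank_QSqrt hp]
  let e := Fintype.equivOfCardEq hc
  have hsub : Subsingleton {w : NumberField.InfinitePlace (QSqrt p) // w ≠ w'} := by
    rw [← Fintype.card_le_one_iff_subsingleton, hc, Fintype.card_fin, rank_QSqrt hp]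
  rw [NumberField.Units.regulator_eq_det _ w' e,
    Matrix.det_eq_elem_of_subsingleton _ ⟨w₀, hw'.symm⟩]
  have hm : w₀.mult = 1 := NumberField.InfinitePlace.mult_isReal ⟨w₀, ⟨φ, hφ, rfl⟩⟩
  have hval (u : (𝓞 (QSqrt p))ˣ) : w₀ ((u : 𝓞 (QSqrt p)) : QSqrt p) = |unitVal p u| := by
    rw [NumberField.InfinitePlace.apply]
    simp [φ, unitVal]
  simp only [Matrix.of_apply, hm, Nat.cast_one, one_mul, hval]
  exact log_fundamentalUnit_le hp (fundSystem_notMem_torsion _ _)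

theorem two_mul_classNumber_mul_log_le {p : ℕ} (hp : p.Prime) (h4 : p % 4 = 1) :
    2 * (NumberField.classNumber (QSqrt p) : ℝ) * Real.log (fundamentalUnit p) ≤
      √p * NumberField.dedekindZeta_residue (QSqrt p) := by
  rw [NumberField.dedekindZeta_residue_def, (nrRealPlaces_nrComplexPlaces hp).1,
    (nrRealPlaces_nrComplexPlaces hp).2]
  have hD : √|(NumberField.discr (QSqrt p) : ℝ)| ≤ √p := by
    apply Real.sqrt_le_sqrt
    exact_mod_cast abs_discr_le hp h4
  have hD0 : 0 < √|(NumberField.discr (QSqrt p) : ℝ)| :=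
    Real.sqrt_pos.2 (abs_pos.2 (Int.cast_ne_zero.2 (NumberField.discr_ne_zero _)))
  have hw : (NumberField.Units.torsionOrder (QSqrt p) : ℝ) ≤ 2 := by
    exact_mod_cast torsionOrder_le_two p
  have hw0 : (0 : ℝ) < NumberField.Units.torsionOrder (QSqrt p) := by
    exact_mod_cast NumberField.Units.torsionOrder_pos (QSqrt p)
  have hR := NumberField.Units.regulator_pos (QSqrt p)
  rw [← mul_div_assoc, le_div_iff₀ (by positivity)]
  calc _ ≤ 2 * (NumberField.classNumber (QSqrt p) : ℝ) * NumberField.Units.regulator (QSqrt p) *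
        (2 * √p) := by
        gcongr
        exact log_fundamentalUnit_le_regulator hp
    _ = _ := by ring


section EulerBound

variable {R : Type*} [CommRing R] [IsDedekindDomain R]

/-- A finite form of the Euler product for a sum over ideals, as an inequality. -/
theorem sum_ideal_le_prod_geometric (f : Ideal R →* ℝ) (h0 : ∀ I, 0 ≤ f I)
    (S : Finset (Ideal R)) (hS : ∀ P ∈ S, Prime P ∧ f P < 1) (T : Finset (Ideal R))
    (hT : ∀ I ∈ T, I ≠ 0 ∧ ∀ P, Prime P → P ∣ I → P ∈ S) :
    ∑ I ∈ T, f I ≤ ∏ P ∈ S, (1 - f P)⁻¹ := by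
  classical
  induction S using Finset.induction_on generalizing T with
  | empty =>
    have hsub : T ⊆ {1} := by
      intro I hI
      rw [Finset.mem_singleton]
      by_contra hne
      obtain ⟨P, hP, hd⟩ := WfDvdMonoid.exists_irreducible_factor
        (fun hu => hne (isUnit_iff_eq_one.1 hu)) (hT I hI).1
      exact absurd ((hT I hI).2 P hP.prime hd) (Finset.notMem_empty _)
    calc ∑ I ∈ T, f I ≤ ∑ I ∈ {1}, f I :=
          Finset.sum_le_sum_of_subset_of_nonneg hsub fun _ _ _ => h0 _
      _ = _ := by rw [Finset.sum_singleton, map_one, Finset.prod_empty]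
  | insert P S hPS ih =>
    obtain ⟨hP, hP1⟩ := hS P (Finset.mem_insert_self _ _)
    have hex : ∀ I : Ideal R, ∃ kJ : ℕ × Ideal R, I ≠ 0 → I = P ^ kJ.1 * kJ.2 ∧ ¬ P ∣ kJ.2 := by
      intro I
      by_cases hI : I = 0
      · exact ⟨(0, 0), fun h => absurd hI h⟩
      · obtain ⟨c, hc, hc'⟩ :=
          (FiniteMultiplicity.of_prime_left hP hI).exists_eq_pow_mul_and_not_dvd
        exact ⟨(multiplicity P I, c), fun _ => ⟨hc, hc'⟩⟩
    choose g hg using hex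
    have hinj : Set.InjOn g T := by
      intro I hI J hJ hIJ
      rw [(hg I (hT I hI).1).1, (hg J (hT J hJ).1).1, hIJ]
    have hJ : ∑ J ∈ T.image (fun I => (g I).2), f J ≤ ∏ P ∈ S, (1 - f P)⁻¹ := by
      refine ih (fun Q hQ => hS Q (Finset.mem_insert_of_mem hQ)) _ fun J hJ => ?_
      obtain ⟨I, hI, rfl⟩ := Finset.mem_image.1 hJ
      obtain ⟨h1, h2⟩ := hg I (hT I hI).1
      refine ⟨fun h => h2 (h ▸ dvd_zero _), fun Q hQ hd => ?_⟩
      have := (hT I hI).2 Q hQ (h1 ▸ hd.mul_left _)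
      rcases Finset.mem_insert.1 this with rfl | h
      · exact absurd hd h2
      · exact h
    rw [Finset.prod_insert hPS]
    calc ∑ I ∈ T, f I = ∑ I ∈ T, f P ^ (g I).1 * f (g I).2 := by
          refine Finset.sum_congr rfl fun I hI => ?_
          conv_lhs => rw [(hg I (hT I hI).1).1]
          rw [map_mul, map_pow]
      _ = ∑ x ∈ T.image g, f P ^ x.1 * f x.2 := 
          (Finset.sum_image (f := fun x : ℕ × Ideal R => f P ^ x.1 * f x.2) hinj).symm
      _ ≤ ∑ x ∈ (T.image fun I => (g I).1) ×ˢ (T.image fun I => (g I).2),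
            f P ^ x.1 * f x.2 := by
          refine Finset.sum_le_sum_of_subset_of_nonneg ?_ fun x _ _ =>
            mul_nonneg (pow_nonneg (h0 _) _) (h0 _)
          intro x hx
          obtain ⟨I, hI, rfl⟩ := Finset.mem_image.1 hx
          exact Finset.mem_product.2
            ⟨Finset.mem_image_of_mem _ hI, Finset.mem_image_of_mem _ hI⟩
      _ = (∑ k ∈ T.image fun I => (g I).1, f P ^ k) * ∑ J ∈ T.image fun I => (g I).2, f J := by
          rw [Finset.sum_mul_sum, Finset.sum_product]
      _ ≤ _ := by
          refine mul_le_mul ?_ hJ (Finset.sum_nonneg fun _ _ => h0 _)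
            (inv_nonneg.2 (by linarith))
          rw [← tsum_geometric_of_lt_one (h0 P) hP1]
          exact (summable_geometric_of_lt_one (h0 P) hP1).sum_le_tsum _
            fun _ _ => pow_nonneg (h0 _) _

end EulerBound

/-- The ideal norm to the power `-s`, as a monoid homomorphism. -/
noncomputable def normRpow (K : Type*) [Field K] [NumberField K] (s : ℝ) : Ideal (𝓞 K) →* ℝ where
  toFun I := (Ideal.absNorm I : ℝ) ^ (-s)
  map_one' := by simp
  map_mul' I J := by
    rw [map_mul, Nat.cast_mul, Real.mul_rpow (Nat.cast_nonneg _) (Nat.cast_nonneg _)]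

section Quadratic

variable {K : Type*} [Field K] [NumberField K]

theorem absNorm_span_natCast (hK : Module.finrank ℚ K = 2) (q : ℕ) :
    Ideal.absNorm (Ideal.span {(q : 𝓞 K)}) = q ^ 2 := by
  rw [Ideal.absNorm_span_singleton, ← map_natCast (algebraMap ℤ (𝓞 K)), Algebra.norm_algebraMap,
    NumberField.RingOfIntegers.rank, hK]
  simp [Int.natAbs_pow]

theorem prod_absNorm_dvd (hK : Module.finrank ℚ K = 2) (q : ℕ) (T : Finset (Ideal (𝓞 K)))
    (hT : ∀ P ∈ T, Prime P ∧ P ∣ Ideal.span {(q : 𝓞 K)}) :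
    ∏ P ∈ T, Ideal.absNorm P ∣ q ^ 2 := by
  rw [← absNorm_span_natCast hK q, ← map_prod]
  exact map_dvd _ (Finset.prod_primes_dvd _ (fun P hP => (hT P hP).1) fun P hP => (hT P hP).2)

theorem absNorm_eq_or (hK : Module.finrank ℚ K = 2) {q : ℕ} (hq : q.Prime) {P : Ideal (𝓞 K)}
    (hP : Prime P) (hd : P ∣ Ideal.span {(q : 𝓞 K)}) :
    Ideal.absNorm P = q ∨ Ideal.absNorm P = q ^ 2 := by
  have h := map_dvd Ideal.absNorm hd
  rw [absNorm_span_natCast hK q, Nat.dvd_prime_pow hq] at h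
  obtain ⟨k, hk, h⟩ := h
  interval_cases k
  · rw [pow_zero, Ideal.absNorm_eq_one_iff] at h
    exact absurd (Ideal.isUnit_iff.2 h) hP.not_isUnit
  · left; simpa using h
  · right; exact h

theorem natCast_mem_of_dvd {R : Type*} [CommRing R] {q : ℕ} {P : Ideal R}
    (hd : P ∣ Ideal.span {(q : R)}) : (q : R) ∈ P :=
  Ideal.le_of_dvd hd (Ideal.mem_span_singleton_self _)

/-- An integer lying in a proper ideal that contains the prime `q` is divisible by `q`. -/
theorem dvd_of_intCast_mem {q : ℕ} (hq : q.Prime) {P : Ideal (𝓞 K)} (hP : P ≠ ⊤)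
    (hqP : (q : 𝓞 K) ∈ P) {m : ℤ} (hm : (m : 𝓞 K) ∈ P) : (q : ℤ) ∣ m := by
  by_contra h
  obtain ⟨a, b, hab⟩ := (Nat.prime_iff_prime_int.1 hq).coprime_iff_not_dvd.2 h
  apply hP
  rw [Ideal.eq_top_iff_one]
  have : (1 : 𝓞 K) = a * (q : 𝓞 K) + b * m := by
    exact_mod_cast congrArg (Int.cast : ℤ → 𝓞 K) hab.symm
  rw [this]
  exact P.add_mem (P.mul_mem_left _ hqP) (P.mul_mem_left _ hm)

theorem exists_sq_of_absNorm_eq {p q : ℕ} (hq : q.Prime) {α : 𝓞 K} (hα : α ^ 2 = p)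
    {P : Ideal (𝓞 K)} (hP : P ≠ ⊤) (hqP : (q : 𝓞 K) ∈ P) (hN : Ideal.absNorm P = q) :
    ∃ n : ℤ, (q : ℤ) ∣ n ^ 2 - p := by
  have : Fact q.Prime := ⟨hq⟩
  have hcard : Nat.card (𝓞 K ⧸ P) = q := by
    rw [← hN, Ideal.absNorm_apply, Submodule.cardQuot_apply]
  have h1 : (1 : 𝓞 K ⧸ P) ≠ 0 := by
    rw [← map_one (Ideal.Quotient.mk P), Ne, Ideal.Quotient.eq_zero_iff_mem,
      ← Ideal.eq_top_iff_one]
    exact hP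
  obtain ⟨n, hn⟩ := AddSubgroup.mem_zmultiples_iff.1
    (mem_zmultiples_of_prime_card hcard h1 (g' := Ideal.Quotient.mk P α))
  refine ⟨n, dvd_of_intCast_mem hq hP hqP ?_⟩
  have h2 : (Ideal.Quotient.mk P) ((n : 𝓞 K) - α) = 0 := by
    rw [map_sub, ← hn, map_intCast, zsmul_one, sub_self]
  rw [Ideal.Quotient.eq_zero_iff_mem] at h2
  have : ((n ^ 2 - p : ℤ) : 𝓞 K) = (n + α) * (n - α) := by
    push_cast
    rw [← hα]; ring
  rw [this]
  exact P.mul_mem_left _ h2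

theorem absNorm_eq_sq_of_legendreSym (hK : Module.finrank ℚ K = 2) {p q : ℕ} [Fact p.Prime]
    (h8 : p % 8 = 1) {α : 𝓞 K} (hα : α ^ 2 = p) (hq : q.Prime) (hχ : legendreSym p q = -1)
    {P : Ideal (𝓞 K)} (hP : Prime P) (hd : P ∣ Ideal.span {(q : 𝓞 K)}) :
    Ideal.absNorm P = q ^ 2 := by
  have : Fact q.Prime := ⟨hq⟩
  refine (absNorm_eq_or hK hq hP hd).resolve_left fun hN => ?_
  have hp2 : p ≠ 2 := by rintro rfl; omega
  have hq2 : q ≠ 2 := by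
    rintro rfl
    rw [Nat.cast_ofNat, legendreSym.at_two hp2, ZMod.χ₈_nat_eq_if_mod_eight] at hχ
    simp [h8, show p % 2 = 1 by omega] at hχ
  have hP' : P ≠ ⊤ := fun h => hP.not_isUnit (Ideal.isUnit_iff.2 h)
  obtain ⟨n, hn⟩ := exists_sq_of_absNorm_eq hq hα hP' (natCast_mem_of_dvd hd) hN
  rw [← legendreSym.quadratic_reciprocity_one_mod_four (by omega) hq2,
    legendreSym.eq_neg_one_iff] at hχ
  refine hχ ⟨n, ?_⟩
  have := (ZMod.intCast_zmod_eq_zero_iff_dvd _ _).2 hn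
  push_cast at this
  push_cast
  linear_combination -this

theorem eq_span_of_dvd_ramified (hK : Module.finrank ℚ K = 2) {p : ℕ} (hp : p.Prime)
    {α : 𝓞 K} (hα : α ^ 2 = p) {P : Ideal (𝓞 K)} (hP : Prime P)
    (hd : P ∣ Ideal.span {(p : 𝓞 K)}) : P = Ideal.span {α} := by
  have h1 : Ideal.span {(p : 𝓞 K)} = Ideal.span {α} ^ 2 := by
    rw [Ideal.span_singleton_pow, hα]
  rw [h1] at hd
  have hN : Ideal.absNorm (Ideal.span {α}) ^ 2 = p ^ 2 := by
    rw [← map_pow, ← h1, absNorm_span_natCast hK]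
  have hN' : Ideal.absNorm (Ideal.span {α}) = p := Nat.pow_left_injective two_ne_zero hN
  have hprime : Prime (Ideal.span {α}) := by
    have := Ideal.isPrime_of_irreducible_absNorm (I := Ideal.span {α}) (by rw [hN']; exact hp)
    refine Ideal.prime_of_isPrime ?_ this
    rintro h
    rw [h, Ideal.absNorm_bot] at hN'
    exact hp.ne_zero hN'.symm
  exact associated_iff_eq.1 (hP.associated_of_dvd hprime (hP.dvd_of_dvd_pow hd))

theorem prod_le_pow {ι : Type*} (T : Finset ι) (f : ι → ℝ) (hf : ∀ i ∈ T, 0 ≤ f i) {y : ℝ}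
    (hy : 1 ≤ y) (hfy : ∀ i ∈ T, f i ≤ y) {k : ℕ} (hk : T.card ≤ k) : ∏ i ∈ T, f i ≤ y ^ k :=
  calc ∏ i ∈ T, f i ≤ ∏ _i ∈ T, y := Finset.prod_le_prod hf hfy
    _ = y ^ T.card := by simp
    _ ≤ y ^ k := pow_le_pow_right₀ hy hk

/-- The local Euler factor of a quadratic field at `q`. -/
theorem prod_local_factor_le (hK : Module.finrank ℚ K = 2) {p q : ℕ} [Fact p.Prime]
    (h8 : p % 8 = 1) {α : 𝓞 K} (hα : α ^ 2 = p) (hq : q.Prime) {s : ℝ} (hs : 1 < s)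
    (T : Finset (Ideal (𝓞 K)))
    (hT : ∀ P ∈ T, Prime P ∧ P ∣ Ideal.span {(q : 𝓞 K)}) :
    ∏ P ∈ T, (1 - normRpow K s P)⁻¹ ≤
      (1 - (q : ℝ) ^ (-s))⁻¹ * (1 - (legendreSym p q : ℝ) * (q : ℝ) ^ (-s))⁻¹ := by
  have hq1 : (1 : ℝ) < q := by exact_mod_cast hq.one_lt
  set x : ℝ := (q : ℝ) ^ (-s) with hx
  have hx0 : 0 < x := Real.rpow_pos_of_pos (by linarith) _
  have hx1 : x < 1 := Real.rpow_lt_one_of_one_lt_of_neg hq1 (by linarith)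
  have hxx : x ^ 2 ≤ x := by nlinarith
  have hval : ∀ P : Ideal (𝓞 K), Ideal.absNorm P = q → normRpow K s P = x := fun P h => by
    simp [normRpow, h, hx]
  have hval2 : ∀ P : Ideal (𝓞 K), Ideal.absNorm P = q ^ 2 → normRpow K s P = x ^ 2 := fun P h => by
    simp only [normRpow, MonoidHom.coe_mk, OneHom.coe_mk, h, hx]
    rw [Nat.cast_pow, ← Real.rpow_natCast, ← Real.rpow_natCast, ← Real.rpow_mul (by linarith),
      ← Real.rpow_mul (by linarith), mul_comm]
  have hle : ∀ P ∈ T, normRpow K s P ≤ x := fun P hP => by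
    rcases absNorm_eq_or hK hq (hT P hP).1 (hT P hP).2 with h | h
    · exact (hval P h).le
    · exact (hval2 P h).le.trans hxx
  have hnn : ∀ P ∈ T, 0 ≤ (1 - normRpow K s P)⁻¹ := fun P hP =>
    inv_nonneg.2 (by linarith [hle P hP])
  have hfac : ∀ P ∈ T, (1 - normRpow K s P)⁻¹ ≤ (1 - x)⁻¹ := fun P hP =>
    inv_anti₀ (by linarith) (by linarith [hle P hP])
  have hone : 1 ≤ (1 - x)⁻¹ := (one_le_inv₀ (by linarith)).2 (by linarith)
  have hdvd := prod_absNorm_dvd hK q T hT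
  have hp0 : ((q : ℤ) : ZMod p) = 0 ↔ q = p := by
    rw [Int.cast_natCast, ZMod.natCast_eq_zero_iff]
    exact ⟨fun h => ((Nat.prime_dvd_prime_iff_eq Fact.out hq).1 h).symm, fun h => h ▸ dvd_rfl⟩
  by_cases h0 : ((q : ℤ) : ZMod p) = 0
  · rw [(legendreSym.eq_zero_iff p q).2 h0]
    have hqp := hp0.1 h0
    subst hqp
    have hc : T.card ≤ 1 := by
      rw [Finset.card_le_one]
      intro P hP Q hQ
      rw [eq_span_of_dvd_ramified hK hq hα (hT P hP).1 (hT P hP).2,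
        eq_span_of_dvd_ramified hK hq hα (hT Q hQ).1 (hT Q hQ).2]
    simpa using prod_le_pow T _ hnn hone hfac hc
  rcases legendreSym.eq_one_or_neg_one p h0 with h1 | h1
  · have hc : T.card ≤ 2 := by
      rw [← Nat.pow_dvd_pow_iff_le_right hq.one_lt]
      refine dvd_trans ?_ hdvd
      rw [← Finset.prod_const]
      refine Finset.prod_dvd_prod_of_dvd _ _ fun P hP => ?_
      rcases absNorm_eq_or hK hq (hT P hP).1 (hT P hP).2 with h | h <;> rw [h]
      exact dvd_pow_self _ two_ne_zero
    have := prod_le_pow T _ hnn hone hfac hc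
    rw [h1, Int.cast_one, one_mul, ← sq]
    exact this
  · have hN : ∀ P ∈ T, Ideal.absNorm P = q ^ 2 := fun P hP =>
      absNorm_eq_sq_of_legendreSym hK h8 hα hq h1 (hT P hP).1 (hT P hP).2
    have hc : T.card ≤ 1 := by
      rw [Finset.prod_congr rfl hN, Finset.prod_const, ← pow_mul,
        Nat.pow_dvd_pow_iff_le_right hq.one_lt] at hdvd
      omega
    have h2 : ∀ P ∈ T, (1 - normRpow K s P)⁻¹ ≤ (1 - x ^ 2)⁻¹ := fun P hP => by
      rw [hval2 P (hN P hP)]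
    have := prod_le_pow T _ hnn ((one_le_inv₀ (by nlinarith)).2 (by nlinarith)) h2 hc
    rw [h1, ← mul_inv]
    refine this.trans_eq ?_
    push_cast
    ring_nf

end Quadratic

open Filter Topology

section Zeta

variable (K : Type*) [Field K] [NumberField K]

/-- The number of ideals of norm `n`. -/
noncomputable def idealCount (n : ℕ) : ℕ := Nat.card {I : Ideal (𝓞 K) // Ideal.absNorm I = n}

theorem idealCount_mul_rpow (s : ℝ) (n : ℕ) :
    (idealCount K n : ℝ) * (n : ℝ) ^ (-s) =
      ∑ I ∈ (Ideal.finite_setOfPred_absNorm_eq (S := 𝓞 K) n).toFinset, normRpow K s I := by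
  have h : ∀ I ∈ (Ideal.finite_setOfPred_absNorm_eq (S := 𝓞 K) n).toFinset,
      normRpow K s I = (n : ℝ) ^ (-s) := by
    intro I hI
    have : Ideal.absNorm I = n := by simpa using hI
    simp [normRpow, this]
  rw [Finset.sum_congr rfl h, Finset.sum_const, nsmul_eq_mul]
  congr 2
  rw [← Set.ncard_eq_toFinset_card _ (Ideal.finite_setOfPred_absNorm_eq (S := 𝓞 K) n)]
  rfl

theorem dedekindZeta_eq_ofReal {s : ℝ} (hs : 1 < s) :
    NumberField.dedekindZeta K s = ((∑' n : ℕ, (idealCount K n : ℝ) * (n : ℝ) ^ (-s) : ℝ) : ℂ) := by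
  rw [NumberField.dedekindZeta, LSeries, Complex.ofReal_tsum]
  refine tsum_congr fun n => ?_
  rcases eq_or_ne n 0 with rfl | hn
  · simp [Real.zero_rpow (by linarith : -s ≠ 0)]
  · rw [LSeries.term_of_ne_zero hn, Real.rpow_neg (Nat.cast_nonneg _)]
    push_cast
    rw [Complex.ofReal_cpow (Nat.cast_nonneg _), div_eq_mul_inv]
    simp [idealCount]

variable {K}

theorem sum_idealCount_le_prod (hK : Module.finrank ℚ K = 2) {p : ℕ} [Fact p.Prime]
    (h8 : p % 8 = 1) {α : 𝓞 K} (hα : α ^ 2 = p) {s : ℝ} (hs : 1 < s) (N : ℕ) :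
    ∑ n ∈ Finset.range N, (idealCount K n : ℝ) * (n : ℝ) ^ (-s) ≤
      ∏ q ∈ N.primesBelow, ((1 - (q : ℝ) ^ (-s))⁻¹ *
        (1 - (legendreSym p q : ℝ) * (q : ℝ) ^ (-s))⁻¹) := by
  classical
  let F (n : ℕ) := (Ideal.finite_setOfPred_absNorm_eq (S := 𝓞 K) n).toFinset
  have hF (n : ℕ) (I) : I ∈ F n ↔ Ideal.absNorm I = n := by simp [F]
  let S (q : ℕ) : Finset (Ideal (𝓞 K)) :=
    (UniqueFactorizationMonoid.normalizedFactors (Ideal.span {(q : 𝓞 K)})).toFinset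
  have hS (q : ℕ) (hq : q.Prime) (P) :
      P ∈ S q ↔ Prime P ∧ P ∣ Ideal.span {(q : 𝓞 K)} := by
    have hne : Ideal.span {(q : 𝓞 K)} ≠ 0 := by
      simpa [Ideal.span_singleton_eq_bot] using hq.ne_zero
    simp only [S, Multiset.mem_toFinset, UniqueFactorizationMonoid.mem_normalizedFactors_iff' hne]
    simp [irreducible_iff_prime, normalize_eq]
  have hprime {q} (hq : q ∈ N.primesBelow) : q.Prime := Nat.prime_of_mem_primesBelow hq
  have hpos : ∀ I : Ideal (𝓞 K), 0 ≤ normRpow K s I := fun I =>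
    Real.rpow_nonneg (Nat.cast_nonneg _) _
  have h1 : ∑ n ∈ Finset.range N, (idealCount K n : ℝ) * (n : ℝ) ^ (-s) =
      ∑ I ∈ ((Finset.range N).erase 0).biUnion F, normRpow K s I := by
    rw [Finset.sum_biUnion]
    · rw [← Finset.sum_erase (a := 0) (f := fun n : ℕ => (idealCount K n : ℝ) * (n : ℝ) ^ (-s))]
      · exact Finset.sum_congr rfl fun n _ => idealCount_mul_rpow K s n
      · simp [Real.zero_rpow (by linarith : -s ≠ 0)]
    · intro m _ n _ hmn
      rw [Function.onFun, Finset.disjoint_left]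
      intro I hI hI'
      exact hmn (((hF m I).1 hI).symm.trans ((hF n I).1 hI'))
  have h2 : ∏ P ∈ N.primesBelow.biUnion S, (1 - normRpow K s P)⁻¹ =
      ∏ q ∈ N.primesBelow, ∏ P ∈ S q, (1 - normRpow K s P)⁻¹ := by
    rw [Finset.prod_biUnion]
    intro q hq r hr hqr
    rw [Function.onFun, Finset.disjoint_left]
    intro P hP hP'
    obtain ⟨hPp, hPq⟩ := (hS q (hprime hq) P).1 hP
    obtain ⟨-, hPr⟩ := (hS r (hprime hr) P).1 hP'
    have hd := dvd_of_intCast_mem (m := r) (hprime hq)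
      (fun h => hPp.not_isUnit (Ideal.isUnit_iff.2 h))
      (natCast_mem_of_dvd hPq) (by simpa using natCast_mem_of_dvd hPr)
    exact hqr ((Nat.prime_dvd_prime_iff_eq (hprime hq) (hprime hr)).1 (by exact_mod_cast hd))
  rw [h1]
  refine (sum_ideal_le_prod_geometric (normRpow K s) hpos (N.primesBelow.biUnion S) ?_ _ ?_).trans ?_
  · intro P hP
    obtain ⟨q, hq, hP⟩ := Finset.mem_biUnion.1 hP
    obtain ⟨hPp, hPq⟩ := (hS q (hprime hq) P).1 hP
    refine ⟨hPp, Real.rpow_lt_one_of_one_lt_of_neg ?_ (by linarith)⟩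
    have := (hprime hq).one_lt
    rcases absNorm_eq_or hK (hprime hq) hPp hPq with h | h <;> rw [h] <;> norm_cast
    nlinarith
  · intro I hI
    obtain ⟨n, hn, hI⟩ := Finset.mem_biUnion.1 hI
    rw [hF] at hI
    obtain ⟨hn0, hnN⟩ := Finset.mem_erase.1 hn
    rw [Finset.mem_range] at hnN
    refine ⟨fun h => hn0 (by rw [← hI, h, Ideal.zero_eq_bot, Ideal.absNorm_bot]), fun P hP hd => ?_⟩
    have hPp : P.IsPrime := Ideal.isPrime_of_prime hP
    have hm : ((Ideal.absNorm P : ℕ) : 𝓞 K) ∈ P := Ideal.absNorm_mem P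
    have hm0 : Ideal.absNorm P ≠ 0 := by
      rw [Ne, Ideal.absNorm_eq_zero_iff]; exact hP.ne_zero
    rw [← Nat.prod_primeFactorsList hm0, Nat.cast_list_prod, ← Multiset.prod_coe] at hm
    obtain ⟨x, hx, hxP⟩ := (hPp.multiset_prod_mem_iff_exists_mem _).1 hm
    obtain ⟨q, hq, rfl⟩ := List.mem_map.1 hx
    have hqp := Nat.prime_of_mem_primeFactorsList hq
    have hle : q ≤ n := by
      refine Nat.le_of_dvd (by omega) ((Nat.dvd_of_mem_primeFactorsList hq).trans ?_)
      rw [← hI]; exact map_dvd _ hd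
    refine Finset.mem_biUnion.2 ⟨q, Nat.mem_primesBelow.2 ⟨by omega, hqp⟩, (hS q hqp P).2 ⟨hP, ?_⟩⟩
    rw [Ideal.dvd_span_singleton]
    exact hxP
  · rw [h2]
    refine Finset.prod_le_prod (fun q hq => Finset.prod_nonneg fun P hP => ?_) fun q hq =>
      prod_local_factor_le hK h8 hα (hprime hq) hs _ fun P hP => (hS q (hprime hq) P).1 hP
    obtain ⟨hPp, hPq⟩ := (hS q (hprime hq) P).1 hP
    refine inv_nonneg.2 (sub_nonneg.2 (Real.rpow_le_one_of_one_le_of_nonpos ?_ (by linarith)))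
    have := Nat.pos_of_ne_zero (mt Ideal.absNorm_eq_zero_iff.1 hPp.ne_zero)
    exact_mod_cast this

end Zeta

/-- The function `n ↦ n ^ (-s)` as a monoid homomorphism. -/
noncomputable def rpowHom {s : ℝ} (hs : 1 < s) : ℕ →*₀ ℝ where
  toFun n := (n : ℝ) ^ (-s)
  map_zero' := by rw [Nat.cast_zero, Real.zero_rpow (by linarith)]
  map_one' := by simp
  map_mul' m n := by rw [Nat.cast_mul, Real.mul_rpow (Nat.cast_nonneg _) (Nat.cast_nonneg _)]

/-- The function `n ↦ (n / p) n ^ (-s)` as a monoid homomorphism. -/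
noncomputable def legendreRpowHom (p : ℕ) [Fact p.Prime] (s : ℝ) : ℕ →*₀ ℝ where
  toFun n := (legendreSym p n : ℝ) * (n : ℝ) ^ (-s)
  map_zero' := by simp [legendreSym.at_zero]
  map_one' := by simp [legendreSym.at_one]
  map_mul' m n := by
    rw [Nat.cast_mul, Nat.cast_mul, Real.mul_rpow (Nat.cast_nonneg _) (Nat.cast_nonneg _),
      legendreSym.mul]
    push_cast; ring

theorem abs_legendreSym_le_one (p : ℕ) [Fact p.Prime] (a : ℤ) : |legendreSym p a| ≤ 1 := by
  by_cases h : (a : ZMod p) = 0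
  · simp [(legendreSym.eq_zero_iff p a).2 h]
  · rcases legendreSym.eq_one_or_neg_one p h with h | h <;> simp [h]

theorem summable_rpow_neg {s : ℝ} (hs : 1 < s) : Summable fun n : ℕ => (n : ℝ) ^ (-s) :=
  Real.summable_nat_rpow.2 (by linarith)

theorem summable_abs_legendreSym_mul_rpow (p : ℕ) [Fact p.Prime] {s : ℝ} (hs : 1 < s) :
    Summable fun n : ℕ => ‖(legendreSym p n : ℝ) * (n : ℝ) ^ (-s)‖ := by
  refine (summable_rpow_neg hs).of_nonneg_of_le (fun _ => norm_nonneg _) fun n => ?_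
  have h0 : (0 : ℝ) ≤ (n : ℝ) ^ (-s) := Real.rpow_nonneg (Nat.cast_nonneg _) _
  rw [norm_mul, Real.norm_of_nonneg h0]
  refine mul_le_of_le_one_left h0 ?_
  rw [Real.norm_eq_abs]
  exact_mod_cast abs_legendreSym_le_one p n

theorem tsum_idealCount_le {K : Type*} [Field K] [NumberField K] (hK : Module.finrank ℚ K = 2)
    {p : ℕ} [Fact p.Prime] (h8 : p % 8 = 1) {α : 𝓞 K} (hα : α ^ 2 = p) {s : ℝ} (hs : 1 < s) :
    ∑' n : ℕ, (idealCount K n : ℝ) * (n : ℝ) ^ (-s) ≤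
      (∑' n : ℕ, (n : ℝ) ^ (-s)) * ∑' n : ℕ, (legendreSym p n : ℝ) * (n : ℝ) ^ (-s) := by
  have hnn (n : ℕ) : 0 ≤ (idealCount K n : ℝ) * (n : ℝ) ^ (-s) :=
    mul_nonneg (Nat.cast_nonneg _) (Real.rpow_nonneg (Nat.cast_nonneg _) _)
  have h1 := EulerProduct.eulerProduct_completely_multiplicative (f := rpowHom hs)
    (summable_rpow_neg hs).norm
  have h2 := EulerProduct.eulerProduct_completely_multiplicative (f := legendreRpowHom p s)
    (summable_abs_legendreSym_mul_rpow p hs)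
  have h3 := h1.mul h2
  refine Real.tsum_le_of_sum_range_le hnn fun N => ?_
  refine ge_of_tendsto h3 ((eventually_ge_atTop N).mono fun M hM => ?_)
  rw [← Finset.prod_mul_distrib]
  exact (Finset.sum_le_sum_of_subset_of_nonneg (Finset.range_mono hM) fun n _ _ => hnn n).trans
    (sum_idealCount_le_prod hK h8 hα hs M)


/-- Upper bound for `∑ c n * g n` by its partial sum up to `M`, obtained from a bound `B` for the
partial sums of `c` by summation by parts. -/
noncomputable def abelBound (c : ℕ → ℝ) (B : ℝ) (g : ℕ → ℝ) (M : ℕ) : ℝ :=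
  ∑ n ∈ Finset.range (M + 1), c n * g n + (B - ∑ n ∈ Finset.range (M + 1), c n) * g (M + 1)

theorem abelBound_antitone {c : ℕ → ℝ} {B : ℝ} (hB : ∀ N, ∑ n ∈ Finset.range N, c n ≤ B)
    {g : ℕ → ℝ} (hg : ∀ n, g (n + 2) ≤ g (n + 1)) : Antitone (abelBound c B g) := by
  refine antitone_nat_of_succ_le fun M => ?_
  have h1 := hB (M + 1 + 1)
  have h2 := mul_nonneg (sub_nonneg.2 h1) (sub_nonneg.2 (hg M))
  unfold abelBound
  rw [Finset.sum_range_succ _ (M + 1), Finset.sum_range_succ c (M + 1)] at *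
  linarith

theorem tsum_le_abelBound {c : ℕ → ℝ} {B : ℝ} (hB : ∀ N, ∑ n ∈ Finset.range N, c n ≤ B)
    {g : ℕ → ℝ} (hg : ∀ n, g (n + 2) ≤ g (n + 1)) (hg0 : ∀ n, 0 ≤ g n)
    (hs : Summable fun n => c n * g n) (M : ℕ) : ∑' n, c n * g n ≤ abelBound c B g M := by
  refine le_of_tendsto ((tendsto_add_atTop_iff_nat 1).2 hs.hasSum.tendsto_sum_nat)
    ((eventually_ge_atTop M).mono fun N hN => ?_)
  refine le_trans ?_ (abelBound_antitone hB hg hN)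
  exact le_add_of_nonneg_right (mul_nonneg (sub_nonneg.2 (hB _)) (hg0 _))

theorem sum_range_legendreSym_eq_zero {p : ℕ} [Fact p.Prime] (hp : p ≠ 2) :
    ∑ n ∈ Finset.range p, legendreSym p n = 0 := by
  have h := quadraticChar_sum_zero (F := ZMod p) (by rwa [ZMod.ringChar_zmod_n])
  rw [← h]
  refine Finset.sum_bij (fun n _ => (n : ZMod p)) (fun _ _ => Finset.mem_univ _) ?_ ?_ ?_
  · intro m hm n hn hmn
    rw [ZMod.natCast_eq_natCast_iff] at hmn
    exact Nat.ModEq.eq_of_lt_of_lt hmn (Finset.mem_range.1 hm) (Finset.mem_range.1 hn)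
  · intro x _
    exact ⟨x.val, Finset.mem_range.2 x.val_lt, by simp⟩
  · intro n _
    simp [legendreSym]

theorem sum_range_legendreSym_le {p : ℕ} [Fact p.Prime] (hp : p ≠ 2) (N : ℕ) :
    ∑ n ∈ Finset.range N, legendreSym p n ≤ ((p - 1) / 2 : ℕ) := by
  have hpp : p.Prime := Fact.out
  have h0 := sum_range_legendreSym_eq_zero hp
  induction N using Nat.strong_induction_on with
  | _ N ih =>
    rcases lt_or_ge N p with hN | hN
    · rcases Nat.eq_zero_or_pos N with rfl | hN0
      · rw [Finset.range_zero, Finset.sum_empty]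
        positivity
      have h1 : ∑ n ∈ Finset.range N, legendreSym p n ≤ N - 1 := by
        obtain ⟨k, rfl⟩ := Nat.exists_eq_succ_of_ne_zero hN0.ne'
        rw [Finset.sum_range_succ']
        have := Finset.sum_le_card_nsmul (Finset.range k)
          (fun n => legendreSym p ((n + 1 : ℕ) : ℤ)) 1
          fun n _ => (abs_le.1 (abs_legendreSym_le_one p _)).2
        simp only [Nat.cast_zero, legendreSym.at_zero]
        simp at this ⊢
        linarith
      have h2 : -(∑ n ∈ Finset.Ico N p, legendreSym p n) ≤ p - N := by
        rw [← Finset.sum_neg_distrib]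
        have := Finset.sum_le_card_nsmul (Finset.Ico N p)
          (fun n : ℕ => -legendreSym p (n : ℤ)) 1
          fun n _ => (abs_le.1 (by rw [abs_neg]; exact abs_legendreSym_le_one p _)).2
        simp at this ⊢
        rw [Nat.cast_sub hN.le] at this
        linarith
      rw [← Finset.sum_range_add_sum_Ico _ hN.le] at h0
      omega
    · obtain ⟨m, rfl⟩ := Nat.exists_eq_add_of_le hN
      rw [Finset.sum_range_add, h0, zero_add]
      have := ih m (by have := hpp.pos; omega)
      refine le_of_eq_of_le (Finset.sum_congr rfl fun n _ => ?_) this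
      rw [legendreSym.mod p ((p + n : ℕ) : ℤ), legendreSym.mod p (n : ℤ)]
      simp

/-- The upper bound `abelBound` for the value at `1` of the `L`-function of `(· / p)`. -/
noncomputable def legendreBound (p : ℕ) [Fact p.Prime] (M : ℕ) : ℝ :=
  abelBound (fun n => (legendreSym p n : ℝ)) ((p - 1) / 2 : ℕ) (fun n => (n : ℝ)⁻¹) M

theorem tendsto_rpow_neg_one {a : ℝ} (ha : a ≠ 0) :
    Tendsto (fun s : ℝ => a ^ (-s)) (𝓝 1) (𝓝 a⁻¹) :=
  ((Real.continuous_const_rpow ha).comp continuous_neg).tendsto' 1 _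
    (by simp [Real.rpow_neg_one])

theorem residue_le_legendreBound {K : Type*} [Field K] [NumberField K]
    (hK : Module.finrank ℚ K = 2) {p : ℕ} [Fact p.Prime] (h8 : p % 8 = 1) {α : 𝓞 K}
    (hα : α ^ 2 = p) (M : ℕ) : NumberField.dedekindZeta_residue K ≤ legendreBound p M := by
  have hp2 : p ≠ 2 := by rintro rfl; omega
  have hB (N : ℕ) : ∑ n ∈ Finset.range N, (legendreSym p n : ℝ) ≤ ((p - 1) / 2 : ℕ) := by
    rw [← Int.cast_sum, ← Int.cast_natCast]
    exact Int.cast_le.2 (sum_range_legendreSym_le hp2 N)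
  have h1 : Tendsto (fun s : ℝ => (s - 1) * ∑' n : ℕ, (idealCount K n : ℝ) * (n : ℝ) ^ (-s))
      (𝓝[>] 1) (𝓝 (NumberField.dedekindZeta_residue K)) := by
    have h := (Complex.continuous_re.tendsto _).comp
      (NumberField.tendsto_sub_one_mul_dedekindZeta_nhdsGT K)
    rw [Complex.ofReal_re] at h
    refine h.congr' ?_
    filter_upwards [self_mem_nhdsWithin] with s hs
    rw [Function.comp_apply, dedekindZeta_eq_ofReal K hs]
    norm_cast
  have h2 : Tendsto (fun s : ℝ => (s - 1) * ∑' n : ℕ, (n : ℝ) ^ (-s)) (𝓝[>] 1) (𝓝 1) := by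
    refine tendsto_sub_mul_tsum_nat_rpow.congr fun s => ?_
    simp [Real.rpow_neg]
  have h3 : Tendsto (fun s : ℝ => abelBound (fun n => (legendreSym p n : ℝ)) ((p - 1) / 2 : ℕ)
      (fun n => (n : ℝ) ^ (-s)) M) (𝓝[>] 1) (𝓝 (legendreBound p M)) := by
    refine Tendsto.mono_left ?_ nhdsWithin_le_nhds
    have hn (n : ℕ) : Tendsto (fun s : ℝ => (legendreSym p n : ℝ) * (n : ℝ) ^ (-s)) (𝓝 1)
        (𝓝 ((legendreSym p n : ℝ) * (n : ℝ)⁻¹)) := by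
      rcases eq_or_ne n 0 with rfl | hn
      · simp [legendreSym.at_zero]
      · exact (tendsto_rpow_neg_one (Nat.cast_ne_zero.2 hn)).const_mul _
    have hM : Tendsto (fun s : ℝ => ((M + 1 : ℕ) : ℝ) ^ (-s)) (𝓝 1) (𝓝 (((M + 1 : ℕ) : ℝ)⁻¹)) :=
      tendsto_rpow_neg_one (by positivity)
    exact (tendsto_finsetSum _ fun n _ => hn n).add (hM.const_mul _)
  have h4 := h2.mul h3
  rw [one_mul] at h4
  refine le_of_tendsto_of_tendsto h1 h4 ?_
  filter_upwards [self_mem_nhdsWithin] with s hs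
  have hs : 1 < s := hs
  rw [mul_assoc]
  refine mul_le_mul_of_nonneg_left ((tsum_idealCount_le hK h8 hα hs).trans ?_) (by linarith)
  refine mul_le_mul_of_nonneg_left ?_
    (tsum_nonneg fun n => Real.rpow_nonneg (Nat.cast_nonneg _) _)
  refine tsum_le_abelBound hB (fun n => ?_) (fun n => Real.rpow_nonneg (Nat.cast_nonneg _) _)
    (summable_abs_legendreSym_mul_rpow p hs).of_norm M
  refine Real.rpow_le_rpow_of_nonpos (by positivity) ?_ (by linarith)
  push_cast; linarith

theorem abelBound_le_harmonic {c : ℕ → ℝ} (hc0 : c 0 = 0) (hc : ∀ n, c n ≤ 1) (B : ℕ) :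
    abelBound c B (fun n => (n : ℝ)⁻¹) B ≤ harmonic B := by
  unfold abelBound
  have h : ((harmonic B : ℚ) : ℝ) = ∑ n ∈ Finset.range B, ((n + 1 : ℕ) : ℝ)⁻¹ := by
    simp [harmonic]
  have h2 : ∑ n ∈ Finset.range B,
      (1 - c (n + 1)) * (((n + 1 : ℕ) : ℝ)⁻¹ - ((B + 1 : ℕ) : ℝ)⁻¹) ≥ 0 := by
    refine Finset.sum_nonneg fun n hn => mul_nonneg (sub_nonneg.2 (hc _)) (sub_nonneg.2 ?_)
    have := Finset.mem_range.1 hn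
    exact inv_anti₀ (by positivity) (by exact_mod_cast (by omega : n + 1 ≤ B + 1))
  have h3 : ∑ n ∈ Finset.range B,
      (1 - c (n + 1)) * (((n + 1 : ℕ) : ℝ)⁻¹ - ((B + 1 : ℕ) : ℝ)⁻¹) =
      ∑ n ∈ Finset.range B, ((n + 1 : ℕ) : ℝ)⁻¹ -
        ∑ n ∈ Finset.range B, c (n + 1) * ((n + 1 : ℕ) : ℝ)⁻¹
      - (B - ∑ n ∈ Finset.range B, c (n + 1)) * ((B + 1 : ℕ) : ℝ)⁻¹ := by
    rw [sub_mul, Finset.sum_mul, ← Finset.sum_sub_distrib]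
    rw [show (B : ℝ) * ((B + 1 : ℕ) : ℝ)⁻¹ = ∑ n ∈ Finset.range B, ((B + 1 : ℕ) : ℝ)⁻¹ by simp,
      ← Finset.sum_sub_distrib, ← Finset.sum_sub_distrib]
    exact Finset.sum_congr rfl fun n _ => by ring
  rw [Finset.sum_range_succ', Finset.sum_range_succ' c, hc0, h]
  linarith

theorem legendreBound_le_one_add_log {p : ℕ} [Fact p.Prime] :
    legendreBound p ((p - 1) / 2) ≤ 1 + Real.log ((p - 1) / 2 : ℕ) := by
  refine (abelBound_le_harmonic (by simp [legendreSym.at_zero]) (fun n => ?_) _).trans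
    (harmonic_le_one_add_log _)
  exact_mod_cast (abs_le.1 (abs_legendreSym_le_one p n)).2


theorem isIntegral_sqrtElt (d : ℕ) : IsIntegral ℤ (sqrtElt d) := by
  refine IsIntegral.of_pow (n := 2) two_pos ?_
  rw [sqrtElt_sq]
  simpa using isIntegral_algebraMap (R := ℤ) (A := QSqrt d) (x := (d : ℤ))

theorem beta_le_half {p : ℕ} [Fact p.Prime] (h8 : p % 8 = 1) (M : ℕ) {c : ℝ}
    (hc : legendreBound p M ≤ c)
    (h : Real.log p + √p * c ≤ (p - 1) * Real.log 2 / 2) : beta p ≤ 1 / 2 := by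
  have hp : p.Prime := Fact.out
  have h1 : (1 : ℝ) < p := by exact_mod_cast hp.one_lt
  have hlog := Real.log_pos one_lt_two
  rw [beta, div_le_iff₀ (mul_pos (by linarith) hlog)]
  have h2 := two_mul_classNumber_mul_log_le hp (by omega)
  have h3 := residue_le_legendreBound (finrank_QSqrt hp) h8
    (α := ⟨sqrtElt p, isIntegral_sqrtElt p⟩)
    (NumberField.RingOfIntegers.ext (sqrtElt_sq p)) M
  have h4 := mul_le_mul_of_nonneg_left (h3.trans hc) (Real.sqrt_nonneg (p : ℝ))
  linarith

theorem beta_le_half_of_ge {p : ℕ} [Fact p.Prime] (h8 : p % 8 = 1) (hp : 400 ≤ p) :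
    beta p ≤ 1 / 2 := by
  refine beta_le_half h8 ((p - 1) / 2) legendreBound_le_one_add_log ?_
  have hpR : (400 : ℝ) ≤ p := by exact_mod_cast hp
  set t := √(p : ℝ) with ht
  have htp : t ^ 2 = p := Real.sq_sqrt (Nat.cast_nonneg _)
  have ht20 : 20 ≤ t := Real.le_sqrt_of_sq_le (by linarith)
  have hlt : Real.log t ≤ t / 20 - 1 + Real.log 20 := by
    have := Real.log_le_sub_one_of_pos (show 0 < t / 20 by positivity)
    rw [Real.log_div (by positivity) (by norm_num)] at this
    linarith
  have h20 : Real.log 20 ≤ 4 * Real.log 2 + 1 / 4 := by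
    have := Real.log_le_sub_one_of_pos (show (0 : ℝ) < 5 / 4 by norm_num)
    rw [show (20 : ℝ) = 2 ^ 4 * (5 / 4) by norm_num, Real.log_mul (by norm_num) (by norm_num),
      Real.log_pow]
    push_cast
    linarith
  have hlogp : Real.log p = 2 * Real.log t := by rw [← htp, Real.log_pow]; norm_num
  have hhalf : Real.log ((p - 1) / 2 : ℕ) ≤ 2 * Real.log t - Real.log 2 := by
    rw [← hlogp, ← Real.log_div (by positivity) (by norm_num)]
    have hpos : (0 : ℝ) < ((p - 1) / 2 : ℕ) := by
      have : 0 < (p - 1) / 2 := by omega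
      exact_mod_cast this
    refine Real.log_le_log hpos ?_
    rw [le_div_iff₀ two_pos]
    have : (p - 1) / 2 * 2 ≤ p := by omega
    exact_mod_cast this
  have hl1 := Real.log_two_gt_d9
  have hl2 := Real.log_two_lt_d9
  have h1 : Real.log t ≤ t / 20 + 2.02259 := by linarith
  have h2 : t * (1 + Real.log ((p - 1) / 2 : ℕ)) ≤ t * (t / 10 + 4.35204) :=
    mul_le_mul_of_nonneg_left (by linarith) (by linarith)
  have h3 : (p - 1) * 0.6931471803 / 2 ≤ (p - 1) * Real.log 2 / 2 := by
    have := mul_le_mul_of_nonneg_left hl1.le (show (0 : ℝ) ≤ p - 1 by linarith)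
    linarith
  refine le_trans ?_ h3
  rw [hlogp]
  nlinarith

theorem log_le_of_pow_two (k : ℕ) {x : ℝ} (hx : 0 < x) :
    Real.log x ≤ k * Real.log 2 + (x / 2 ^ k - 1) := by
  have := Real.log_le_sub_one_of_pos (show 0 < x / 2 ^ k by positivity)
  rw [Real.log_div hx.ne' (by positivity), Real.log_pow] at this
  linarith

theorem beta_le_half_of_numeric {p : ℕ} [Fact p.Prime] (h8 : p % 8 = 1) (M k : ℕ) {c r : ℝ}
    (hc : legendreBound p M ≤ c) (hc0 : 0 ≤ c) (hr0 : 0 ≤ r) (hr : (p : ℝ) ≤ r ^ 2)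
    (hk : 2 * k ≤ p - 1)
    (h : (p : ℝ) / 2 ^ k - 1 + r * c ≤ ((p - 1) / 2 - k) * 0.6931471803) : beta p ≤ 1 / 2 := by
  have hp : p.Prime := Fact.out
  have hp1 := hp.one_lt
  refine beta_le_half h8 M hc ?_
  have h1 := log_le_of_pow_two k (show (0 : ℝ) < p by exact_mod_cast hp.pos)
  have h2 : √p * c ≤ r * c := mul_le_mul_of_nonneg_right (Real.sqrt_le_iff.2 ⟨hr0, hr⟩) hc0
  have h3 : (0 : ℝ) ≤ (p - 1) / 2 - k := by
    have : 2 * k + 1 ≤ p := by omega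
    have : (2 * k + 1 : ℝ) ≤ p := by exact_mod_cast this
    linarith
  have h4 := mul_le_mul_of_nonneg_left Real.log_two_gt_d9.le h3
  linarith

theorem beta_41_le : beta 41 ≤ 1 / 2 := by
  have : Fact (Nat.Prime 41) := ⟨by norm_num⟩
  refine beta_le_half_of_numeric (by norm_num) 78 5 (c := 1.551) (r := 6.404) ?_ (by norm_num)
    (by norm_num) (by norm_num) (by norm_num) (by norm_num)
  norm_num [legendreBound, abelBound, Finset.sum_range_succ]

theorem beta_97_le : beta 97 ≤ 1 / 2 := by
  have : Fact (Nat.Prime 97) := ⟨by norm_num⟩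
  refine beta_le_half_of_numeric (by norm_num) 50 6 (c := 2.846) (r := 9.849) ?_ (by norm_num)
    (by norm_num) (by norm_num) (by norm_num) (by norm_num)
  norm_num [legendreBound, abelBound, Finset.sum_range_succ]

theorem beta_137_le : beta 137 ≤ 1 / 2 := by
  have : Fact (Nat.Prime 137) := ⟨by norm_num⟩
  refine beta_le_half_of_numeric (by norm_num) 34 7 (c := 3.32) (r := 11.705) ?_ (by norm_num)
    (by norm_num) (by norm_num) (by norm_num) (by norm_num)
  norm_num [legendreBound, abelBound, Finset.sum_range_succ]

theorem beta_193_le : beta 193 ≤ 1 / 2 := by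
  have : Fact (Nat.Prime 193) := ⟨by norm_num⟩
  refine beta_le_half_of_numeric (by norm_num) 46 7 (c := 4.2) (r := 13.893) ?_ (by norm_num)
    (by norm_num) (by norm_num) (by norm_num) (by norm_num)
  norm_num [legendreBound, abelBound, Finset.sum_range_succ]

theorem beta_313_le : beta 313 ≤ 1 / 2 := by
  have : Fact (Nat.Prime 313) := ⟨by norm_num⟩
  refine beta_le_half_of_numeric (by norm_num) 46 8 (c := 5.46) (r := 17.692) ?_ (by norm_num)
    (by norm_num) (by norm_num) (by norm_num) (by norm_num)
  norm_num [legendreBound, abelBound, Finset.sum_range_succ]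


theorem exists_eq_add_mul_sqrtElt {p : ℕ} (hp : p.Prime) (x : QSqrt p) :
    ∃ r t : ℚ, x = algebraMap ℚ _ r + algebraMap ℚ _ t * sqrtElt p := by
  let pb := IntermediateField.adjoin.powerBasis (isIntegral_sqrt p)
  have hdim : pb.dim = 2 := by rw [← pb.finrank, finrank_QSqrt hp]
  obtain ⟨f, hf, hx⟩ := pb.exists_eq_aeval x
  obtain ⟨a, b, rfl⟩ := Polynomial.exists_eq_X_add_C_of_natDegree_le_one (by omega : f.natDegree ≤ 1)
  refine ⟨b, a, ?_⟩
  rw [hx]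
  simp only [map_add, map_mul, Polynomial.aeval_C, Polynomial.aeval_X]
  rw [add_comm]
  rfl

/-- The real embedding of `ℚ(√p)` other than the inclusion. -/
theorem exists_conj_embedding {p : ℕ} (hp : p.Prime) :
    ∃ σ : QSqrt p →ₐ[ℚ] ℝ, σ (sqrtElt p) = -√(p : ℝ) := by
  let pb := IntermediateField.adjoin.powerBasis (isIntegral_sqrt p)
  have hgen : pb.gen = sqrtElt p := IntermediateField.adjoin.powerBasis_gen _
  have h0 : Polynomial.aeval (-√(p : ℝ)) (minpoly ℚ pb.gen) = 0 := by
    have hmin : minpoly ℚ pb.gen = minpoly ℚ √(p : ℝ) := by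
      rw [IntermediateField.adjoin.powerBasis_gen]
      exact IntermediateField.minpoly_gen ℚ _
    rw [hmin, minpoly_sqrt hp]
    simp
  exact ⟨pb.lift _ h0, by rw [← hgen]; exact pb.lift_gen _ h0⟩

theorem exists_int_of_isIntegral {q : ℚ} (h : IsIntegral ℤ (q : ℝ)) : ∃ a : ℤ, (a : ℚ) = q := by
  have : IsIntegral ℤ q :=
    (isIntegral_algebraMap_iff (A := ℚ) (B := ℝ) (algebraMap ℚ ℝ).injective).1 (by simpa using h)
  obtain ⟨a, ha⟩ := IsIntegrallyClosed.isIntegral_iff.1 this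
  exact ⟨a, by simpa using ha⟩

theorem exists_int_of_prime_mul_sq {p : ℕ} (hp : p.Prime) {c : ℚ} {m : ℤ}
    (h : p * c ^ 2 = m) : ∃ f : ℤ, (f : ℚ) = c := by
  have hp0 : (p : ℚ) ≠ 0 := by exact_mod_cast hp.ne_zero
  have hint : IsIntegral ℤ ((p : ℚ) * c) := by
    refine IsIntegral.of_pow (n := 2) two_pos ?_
    rw [show ((p : ℚ) * c) ^ 2 = ((p * m : ℤ) : ℚ) by push_cast; rw [← h]; ring]
    exact isIntegral_intCast _
  obtain ⟨e, he⟩ := IsIntegrallyClosed.isIntegral_iff.1 hint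
  have he' : (e : ℚ) = p * c := by simpa using he
  have h2 : e ^ 2 = p * m := by
    have : (e : ℚ) ^ 2 = p * m := by rw [he', ← h]; ring
    exact_mod_cast this
  obtain ⟨f, rfl⟩ := (Nat.prime_iff_prime_int.1 hp).dvd_of_dvd_pow (Dvd.intro _ h2.symm)
  refine ⟨f, mul_left_cancel₀ hp0 ?_⟩
  rw [← he']; push_cast; ring

/-- The units `> 1` of `ℚ(√p)` are of the form `(a + b√p) / 2` with `a, b > 0`
and `a² - p b² = ±4`. -/
theorem exists_unitVal_eq {p : ℕ} (hp : p.Prime) {u : (𝓞 (QSqrt p))ˣ} (hu : 1 < unitVal p u) :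
    ∃ a b : ℤ, 0 < a ∧ 0 < b ∧ 2 * unitVal p u = a + b * √(p : ℝ) ∧
      (a ^ 2 - p * b ^ 2 = 4 ∨ a ^ 2 - p * b ^ 2 = -4) := by
  obtain ⟨σ, hσ⟩ := exists_conj_embedding hp
  let S (v : 𝓞 (QSqrt p)) : ℝ := ((v : QSqrt p) : ℝ)
  let S' (v : 𝓞 (QSqrt p)) : ℝ := σ (v : QSqrt p)
  have key (v : 𝓞 (QSqrt p)) : ∃ r t : ℚ, S v = r + t * √p ∧ S' v = r - t * √p := by
    obtain ⟨r, t, h⟩ := exists_eq_add_mul_sqrtElt hp (v : QSqrt p)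
    refine ⟨r, t, ?_, ?_⟩
    · simp only [S, h]
      simp [coe_sqrtElt]
    · simp only [S', h, map_add, map_mul, AlgHom.commutes, hσ]
      simp; ring
  have hsq : √(p : ℝ) ^ 2 = p := Real.sq_sqrt (Nat.cast_nonneg _)
  have hiS (v : 𝓞 (QSqrt p)) : IsIntegral ℤ (S v) :=
    (NumberField.RingOfIntegers.isIntegral_coe v).map ((algebraMap (QSqrt p) ℝ).toIntAlgHom)
  have hiS' (v : 𝓞 (QSqrt p)) : IsIntegral ℤ (S' v) :=
    (NumberField.RingOfIntegers.isIntegral_coe v).map (σ.toRingHom.toIntAlgHom)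
  have hnorm (v : 𝓞 (QSqrt p)) : ∃ n : ℤ, S v * S' v = n := by
    obtain ⟨r, t, h1, h2⟩ := key v
    have h3 : S v * S' v = ((r ^ 2 - p * t ^ 2 : ℚ) : ℝ) := by
      rw [h1, h2]; push_cast; linear_combination -(t : ℝ) ^ 2 * hsq
    obtain ⟨n, hn⟩ := exists_int_of_isIntegral (h3 ▸ (hiS v).mul (hiS' v))
    exact ⟨n, by rw [h3, ← hn]; simp⟩
  obtain ⟨n, hn⟩ := hnorm u
  obtain ⟨m, hm⟩ := hnorm (u⁻¹ : (𝓞 (QSqrt p))ˣ)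
  have hS1 : S u * S (u⁻¹ : (𝓞 (QSqrt p))ˣ) = 1 := by
    simp [S]
  have hS1' : S' u * S' (u⁻¹ : (𝓞 (QSqrt p))ˣ) = 1 := by
    simp [S']
  have hnm : n * m = 1 := by
    have : (n : ℝ) * m = 1 := by
      rw [← hn, ← hm]
      linear_combination S' u * S' (u⁻¹ : (𝓞 (QSqrt p))ˣ) * hS1 + hS1'
    exact_mod_cast this
  have hn1 : n = 1 ∨ n = -1 := Int.eq_one_or_neg_one_of_mul_eq_one hnm
  obtain ⟨r, t, h1, h2⟩ := key u
  obtain ⟨a, ha⟩ : ∃ a : ℤ, (a : ℚ) = 2 * r := by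
    refine exists_int_of_isIntegral ?_
    rw [show ((2 * r : ℚ) : ℝ) = S u + S' u by rw [h1, h2]; push_cast; ring]
    exact (hiS u).add (hiS' u)
  have haR : (a : ℝ) = 2 * r := by exact_mod_cast congrArg (Rat.cast : ℚ → ℝ) ha
  have hab : (p : ℚ) * (2 * t) ^ 2 = ((a ^ 2 - 4 * n : ℤ) : ℚ) := by
    have : (p : ℝ) * (2 * t) ^ 2 = a ^ 2 - 4 * n := by
      rw [← hn, haR, h1, h2]; linear_combination -4 * (t : ℝ) ^ 2 * hsq
    apply Rat.cast_injective (α := ℝ)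
    push_cast
    exact this
  obtain ⟨b, hb⟩ := exists_int_of_prime_mul_sq hp hab
  have hbR : (b : ℝ) = 2 * t := by exact_mod_cast congrArg (Rat.cast : ℚ → ℝ) hb
  have hx : S u = unitVal p u := rfl
  have hy : |S' u| < 1 := by
    have : |S u| * |S' u| = 1 := by
      rw [← abs_mul, hn]
      rcases hn1 with h | h <;> simp [h]
    rw [hx, abs_of_pos (by linarith)] at this
    nlinarith [abs_nonneg (S' u)]
  rw [abs_lt] at hy
  have hp0 : 0 < √(p : ℝ) := Real.sqrt_pos.2 (by exact_mod_cast hp.pos)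
  refine ⟨a, b, ?_, ?_, ?_, ?_⟩
  · have : (0 : ℝ) < a := by rw [haR]; linarith
    exact_mod_cast this
  · have : (0 : ℝ) < b * √p := by rw [hbR]; linarith
    exact_mod_cast pos_of_mul_pos_left this hp0.le
  · rw [← hx, h1, haR, hbR]; ring
  · have : (p : ℤ) * b ^ 2 = a ^ 2 - 4 * n := by
      rw [← hb] at hab
      exact_mod_cast hab
    rcases hn1 with h | h <;> subst h
    · left; linarith
    · right; linarith

theorem half_lt_beta_17 : 1 / 2 < beta 17 := by
  have hp : Nat.Prime 17 := by norm_num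
  obtain ⟨u, hu, hε⟩ := fundamentalUnit_spec hp
  obtain ⟨a, b, ha, hb, hab, hN⟩ := exists_unitVal_eq hp hu.1
  have hb1 : 1 ≤ b ^ 2 := by nlinarith
  have ha4 : 4 ≤ a := by
    by_contra! h
    push_cast at hN
    rcases hN with h | h <;> nlinarith
  have h4 : 4 ≤ fundamentalUnit 17 := by
    rw [hε]
    have h1 : (4 : ℝ) ≤ a := by exact_mod_cast ha4
    have h2 : (1 : ℝ) ≤ b := by exact_mod_cast hb
    have h3 : (4 : ℝ) ≤ √((17 : ℕ) : ℝ) := Real.le_sqrt_of_sq_le (by norm_num)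
    nlinarith
  have hh : (1 : ℝ) ≤ NumberField.classNumber (QSqrt 17) := by
    exact_mod_cast NumberField.classNumber_pos (QSqrt 17)
  have hlog2 := Real.log_pos one_lt_two
  have h5 : 2 * Real.log 2 ≤ Real.log (fundamentalUnit 17) := by
    have := Real.log_le_log (by norm_num) h4
    rwa [show (4 : ℝ) = 2 ^ 2 by norm_num, Real.log_pow, Nat.cast_ofNat] at this
  have h6 : 4 * Real.log 2 < Real.log 17 := by
    have := Real.log_lt_log (by norm_num) (show (2 : ℝ) ^ 4 < 17 by norm_num)
    rwa [Real.log_pow, Nat.cast_ofNat] at this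
  have h7 : 2 * Real.log 2 ≤
      (NumberField.classNumber (QSqrt 17) : ℝ) * Real.log (fundamentalUnit 17) := by nlinarith
  rw [beta, lt_div_iff₀ (by push_cast; linarith)]
  push_cast
  nlinarith


theorem mod_eight_of_mem_P21 {p : ℕ} (hp : p ∈ P21) : p % 8 = 1 := by
  obtain ⟨hpp, h4, ho⟩ := hp
  have : Fact p.Prime := ⟨hpp⟩
  have hp2 : p ≠ 2 := by rintro rfl; omega
  have h2 : (2 : ZMod p) ≠ 0 := by
    intro h
    have : ((2 : ℕ) : ZMod p) = 0 := by exact_mod_cast h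
    rw [ZMod.natCast_eq_zero_iff] at this
    exact hp2 ((Nat.prime_dvd_prime_iff_eq hpp Nat.prime_two).1 this)
  have hsq : IsSquare (2 : ZMod p) := by
    rw [ZMod.euler_criterion p h2]
    rw [show p / 2 = (p - 1) / 2 by omega, ← ho]
    exact pow_orderOf_eq_one _
  have := (ZMod.exists_sq_eq_two_iff hp2).1 hsq
  omega

theorem small_prime_cases : ∀ p ∈ Finset.range 400, p % 8 = 1 ∧ p.Prime ∧
    (∀ k ∈ Finset.Ico 1 ((p - 1) / 2), 2 ^ k % p ≠ 1) →
    p = 17 ∨ p = 41 ∨ p = 97 ∨ p = 137 ∨ p = 193 ∨ p = 313 := by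
  decide +kernel

theorem eq_of_mem_P21_of_lt {p : ℕ} (hp : p ∈ P21) (hlt : p < 400) :
    p = 17 ∨ p = 41 ∨ p = 97 ∨ p = 137 ∨ p = 193 ∨ p = 313 := by
  refine small_prime_cases p (Finset.mem_range.2 hlt)
    ⟨mod_eight_of_mem_P21 hp, hp.1, fun k hk h => ?_⟩
  obtain ⟨hk0, hk⟩ := Finset.mem_Ico.1 hk
  have h1 : (2 : ZMod p) ^ k = 1 := by
    have : ((2 ^ k : ℕ) : ZMod p) = ((1 : ℕ) : ZMod p) := by
      rw [ZMod.natCast_eq_natCast_iff]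
      exact h.trans (Nat.mod_eq_of_lt hp.1.one_lt).symm
    simpa using this
  have := orderOf_le_of_pow_eq_one hk0 h1
  rw [hp.2.2] at this
  omega

theorem orderOf_two_zmod_17 : orderOf (2 : ZMod 17) = 8 :=
  orderOf_eq_prime_pow (p := 2) (n := 2) (by decide) (by decide)

theorem setOf_mem_P21_half_lt_beta : {p : ℕ | p ∈ P21 ∧ beta p > 1 / 2} = {17} := by
  ext p
  rw [Set.mem_ofPred_eq, Set.mem_singleton_iff]
  constructor
  · rintro ⟨hp, hβ⟩
    have : Fact p.Prime := ⟨hp.1⟩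
    rcases lt_or_ge p 400 with hlt | hge
    · rcases eq_of_mem_P21_of_lt hp hlt with rfl | rfl | rfl | rfl | rfl | rfl
      · rfl
      · exact absurd beta_41_le hβ.not_ge
      · exact absurd beta_97_le hβ.not_ge
      · exact absurd beta_137_le hβ.not_ge
      · exact absurd beta_193_le hβ.not_ge
      · exact absurd beta_313_le hβ.not_ge
    · exact absurd (beta_le_half_of_ge (mod_eight_of_mem_P21 hp) hge) hβ.not_ge
  · rintro rfl
    exact ⟨⟨by norm_num, by norm_num, orderOf_two_zmod_17⟩, half_lt_beta_17⟩

end ThueMorse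

theorem mainTheorem6 :
    {p : ℕ | p ∈ ThueMorse.P21 ∧ ThueMorse.beta p > 1 / 2}.Finite ∧
      {p : ℕ | p ∈ ThueMorse.P21 ∧ ThueMorse.beta p > 1 / 2} = {17} := by
  rw [ThueMorse.setOf_mem_P21_half_lt_beta]
  exact ⟨Set.finite_singleton 17, rfl⟩
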